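/- Throughout, a continuous density on $\mathbb R^N$ is a continuous function $g\ge 0$ with $\int g=1$; sample means and sample variances are $\overline x=\frac1m\sum_i x_i$ and $\frac1{m-1}\sum_i(x_i-\overline x)^2$; and $\mathbf P(T>u\mid H_i)$ is the probability of $\{T>u\}$ when the data vector has density $g_i$. In each of the following three cases let $\mathcal G$ be the class of continuous densities that satisfy the stated conditions (a), (b), and let $K$ be the stated functional. Then $0<K(g)<\infty$ for every $g\in\mathcal G$, and for all $g_0,g_1\in\mathcal G$ $$\frac{\mathbf P(T>u\mid H_1)}{\mathbf P(T>u\mid H_0)}\longrightarrow\frac{K(g_1)}{K(g_0)}\qquad\text{as }u\to\infty .$$ (i) One-sample $t$-statistic. Let $n\ge2$, $T=\sqrt n\,\overline X/S$ for $X\in\mathbb R^n$, where $\overline X$ and $S^2$ are the sample mean and variance, and let $I=(1/\sqrt n,\dots,1/\sqrt n)$. Conditions: (a) $g(xI)>0$ for some $x\ge0$; (b) for some $\varepsilon>0$, $$\int_0^\infty r^{n-1}\sup_{\xi\perp I,\ \|\xi\|<\varepsilon}g\bigl(r(I+\xi)\bigr)\,dr<\infty .$$ Functional: $$K(g)=\frac{2\pi^{n/2}}{\Gamma(n/2)}\int_0^\infty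 r^{n-1}g(rI)\,dr .$$ (ii) Two-sample $t$-statistic. Let $n_1,n_2\ge2$, $n=n_1+n_2$, $\alpha,\beta>0$, and $$T=\frac{\overline X_1-\overline X_2}{\sqrt{\alpha S_1^2+\beta S_2^2}},$$ where $\overline X_1,S_1^2$ and $\overline X_2,S_2^2$ are the sample means and variances of the first $n_1$ and of the last $n_2$ coordinates of $X\in\mathbb R^n$. Let $I_1=(1/\sqrt{n_1},\dots,1/\sqrt{n_1},0,\dots,0)$ and $I_2=(0,\dots,0,1/\sqrt{n_2},\dots,1/\sqrt{n_2})$ be the normalized indicator vectors of the two groups of coordinates, $\omega_0=\arccos\sqrt{n_2/n}$ and $v(\omega)=\cos(\omega-\omega_0)I_1+\sin(\omega-\omega_0)I_2$. Conditions: (a) $g(r\,v(\omega))>0$ for some $r\ge0$ and $\omega\in[-\pi/2,\pi/2]$; (b) for some $\varepsilon>0$, $$\int_{-\pi/2}^{\pi/2}\cos(\omega)^{n-2}\int_0^\infty r^{n-1}\sup_{\xi\perp I_1,I_2,\ \|\xi\|<\varepsilon}g\bigl(r(v(\omega)+\xi)\bigr)\,dr\,d\omega<\infty .$$ Functional: $$K(g)=C\int_{-\pi/2}^{\pi/2}\cos(\omega)^{n-2}\int_0^\infty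 r^{n-1}g\bigl(r\,v(\omega)\bigr)\,dr\,d\omega,$$ $$C=\frac{2\pi^{\frac{n-1}2}\bigl(\frac{n_1-1}\alpha\bigr)^{\frac{n_1-1}2}\bigl(\frac{n_2-1}\beta\bigr)^{\frac{n_2-1}2}\bigl(\frac1{n_1}+\frac1{n_2}\bigr)^{\frac{n-2}2}}{\Gamma\bigl(\frac{n-1}2\bigr)(n-2)^{\frac{n-2}2}} .$$ In particular this applies to the Student (pooled-variance) two-sample $t$-statistic, with $\alpha=\frac{n_1-1}{n-2}\bigl(\frac1{n_1}+\frac1{n_2}\bigr)$ and $\beta=\frac{n_2-1}{n-2}\bigl(\frac1{n_1}+\frac1{n_2}\bigr)$, and to the Welch statistic, with $\alpha=1/n_1$ and $\beta=1/n_2$. (iii) $F$-statistic. Let $n_1,n_2\ge2$, $n=n_1+n_2$, $T=S_1^2/S_2^2$, where $S_1^2$ and $S_2^2$ are the sample variances of $X\in\mathbb R^{n_1}$ and $Y\in\mathbb R^{n_2}$, and let $g(x,y)$ denote a joint density of $(X,Y)$. Let $s_1(x)$ be the sample standard deviation of $x\in\mathbb R^{n_1}$ and $I=(1/\sqrt{n_2},\dots,1/\sqrt{n_2})\in\mathbb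 R^{n_2}$. Conditions: (a) $s_1(x)\,g(x,rI)>0$ for some $x\in\mathbb R^{n_1}$ and $r\in\mathbb R$; (b) for some $\varepsilon>0$, $$\int_{\mathbb R^{n_1}}s_1(x)^{n_2-1}\int_{-\infty}^\infty\sup_{\xi\perp I,\ \|\xi\|<\varepsilon}g\bigl(x,rI+s_1(x)\xi\bigr)\,dr\,dx<\infty .$$ Functional: $$K(g)=\frac{\Gamma\bigl(\frac{n_1-1}2\bigr)\bigl(\pi(n_1-1)\bigr)^{\frac{n_2-1}2}}{\Gamma\bigl(\frac{n-2}2\bigr)}\int_{\mathbb R^{n_1}}s_1(x)^{n_2-1}\int_{-\infty}^\infty g(x,rI)\,dr\,dx .$$ -/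

import Mathlib

open MeasureTheory Filter Topology
open scoped ENNReal

noncomputable section

namespace TestTails

/-- `ℝ^ι` with its Euclidean norm and Lebesgue measure. -/
abbrev Euc (ι : Type) [Fintype ι] : Type := EuclideanSpace ℝ ι

/-! ### Sample moments -/

/-- The sample mean. -/
def sampleMean {m : ℕ} (x : Fin m → ℝ) : ℝ :=
  (∑ i, x i) / (m : ℝ)

/-- The (unbiased) sample variance. -/
def sampleVar {m : ℕ} (x : Fin m → ℝ) : ℝ :=
  (∑ i, (x i - sampleMean x) ^ 2) / ((m : ℝ) - 1)

/-- The sample standard deviation. -/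
def sampleSD {m : ℕ} (x : Fin m → ℝ) : ℝ :=
  Real.sqrt (sampleVar x)

/-- The first sample of a vector indexed by `Fin n₁ ⊕ Fin n₂`. -/
def fstSample {n₁ n₂ : ℕ} (x : Euc (Fin n₁ ⊕ Fin n₂)) : Fin n₁ → ℝ :=
  fun i => x (Sum.inl i)

/-- The second sample of a vector indexed by `Fin n₁ ⊕ Fin n₂`. -/
def sndSample {n₁ n₂ : ℕ} (x : Euc (Fin n₁ ⊕ Fin n₂)) : Fin n₂ → ℝ :=
  fun j => x (Sum.inr j)

/-! ### The test statistics -/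

/-- The one-sample `t`-statistic `√n · mean / S`. -/
def oneSampleT (n : ℕ) (x : Euc (Fin n)) : ℝ :=
  Real.sqrt n * (sampleMean x / sampleSD x)

/-- The generalized two-sample `t`-statistic with weights `α`, `β`. -/
def twoSampleT (n₁ n₂ : ℕ) (α β : ℝ) (x : Euc (Fin n₁ ⊕ Fin n₂)) : ℝ :=
  (sampleMean (fstSample x) - sampleMean (sndSample x)) /
    Real.sqrt (α * sampleVar (fstSample x) + β * sampleVar (sndSample x))

/-- The Student two-sample `t`-statistic, with the pooled variance. -/
def studentTwoSampleT (n₁ n₂ : ℕ) (x : Euc (Fin n₁ ⊕ Fin n₂)) : ℝ :=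
  (sampleMean (fstSample x) - sampleMean (sndSample x)) /
    Real.sqrt
      ((((n₁ : ℝ) - 1) * sampleVar (fstSample x) + ((n₂ : ℝ) - 1) * sampleVar (sndSample x))
          / ((n₁ : ℝ) + n₂ - 2) * (1 / (n₁ : ℝ) + 1 / (n₂ : ℝ)))

/-- The Welch statistic. -/
def welchT (n₁ n₂ : ℕ) (x : Euc (Fin n₁ ⊕ Fin n₂)) : ℝ :=
  (sampleMean (fstSample x) - sampleMean (sndSample x)) /
    Real.sqrt (sampleVar (fstSample x) / n₁ + sampleVar (sndSample x) / n₂)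

/-- The `F`-statistic `S₁² / S₂²` for comparison of variances. -/
def fStat (n₁ n₂ : ℕ) (p : Euc (Fin n₁) × Euc (Fin n₂)) : ℝ :=
  sampleVar p.1 / sampleVar p.2

/-! ### Densities -/

/-- `g` is a continuous probability density on `E`. -/
structure IsContDensity {E : Type} [TopologicalSpace E] [MeasureSpace E] (g : E → ℝ) : Prop where
  continuous : Continuous g
  nonneg : ∀ x, 0 ≤ g x
  lintegral_eq_one : ∫⁻ x, ENNReal.ofReal (g x) = 1

/-- Under `P`, the random vector `X` has density `g` with respect to Lebesgue measure. -/
structure HasDensity {Ω E : Type*} [MeasurableSpace Ω] [MeasureSpace E]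
    (P : Measure Ω) (X : Ω → E) (g : E → ℝ) : Prop where
  aemeasurable : AEMeasurable X P
  map_eq : P.map X = (volume : Measure E).withDensity fun x => ENNReal.ofReal (g x)

/-! ### The one-sample `t`-statistic -/

/-- The unit vector `(1/√m, …, 1/√m)`. -/
def unitDiag (m : ℕ) : Euc (Fin m) :=
  WithLp.toLp 2 fun _ => 1 / Real.sqrt m

/-- The class of admissible densities for the one-sample `t`-statistic. -/
structure OneSampleRegular (n : ℕ) (g : Euc (Fin n) → ℝ) : Prop where
  density : IsContDensity g
  pos : ∃ x : ℝ, 0 ≤ x ∧ 0 < g (x • unitDiag n)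
  integrable : ∃ ε : ℝ, 0 < ε ∧
    ∫⁻ r in Set.Ioi (0 : ℝ), ENNReal.ofReal (r ^ (n - 1)) *
      (⨆ ξ : {ξ : Euc (Fin n) // ξ ∈ (Submodule.span ℝ {unitDiag n})ᗮ ∧ ‖ξ‖ < ε},
        ENNReal.ofReal (g (r • (unitDiag n + ξ.1)))) < ⊤

/-- The functional `K` for the one-sample `t`-statistic. -/
def oneSampleK (n : ℕ) (g : Euc (Fin n) → ℝ) : ℝ≥0∞ :=
  ENNReal.ofReal (2 * Real.pi ^ ((n : ℝ) / 2) / Real.Gamma ((n : ℝ) / 2)) *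
    ∫⁻ r in Set.Ioi (0 : ℝ), ENNReal.ofReal (r ^ (n - 1)) * ENNReal.ofReal (g (r • unitDiag n))

/-! ### The two-sample `t`-statistic -/

/-- The unit vector `(1/√n₁, …, 1/√n₁, 0, …, 0)`. -/
def unitFst (n₁ n₂ : ℕ) : Euc (Fin n₁ ⊕ Fin n₂) :=
  WithLp.toLp 2 (Sum.elim (fun _ => 1 / Real.sqrt n₁) (fun _ => 0))

/-- The unit vector `(0, …, 0, 1/√n₂, …, 1/√n₂)`. -/
def unitSnd (n₁ n₂ : ℕ) : Euc (Fin n₁ ⊕ Fin n₂) :=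
  WithLp.toLp 2 (Sum.elim (fun _ => 0) (fun _ => 1 / Real.sqrt n₂))

/-- The angle `ω₀ = arccos √(n₂ / n)`. -/
def omegaZero (n₁ n₂ : ℕ) : ℝ :=
  Real.arccos (Real.sqrt ((n₂ : ℝ) / ((n₁ : ℝ) + n₂)))

/-- The direction `cos (ω - ω₀) I₁ + sin (ω - ω₀) I₂`. -/
def planeDir (n₁ n₂ : ℕ) (ω : ℝ) : Euc (Fin n₁ ⊕ Fin n₂) :=
  Real.cos (ω - omegaZero n₁ n₂) • unitFst n₁ n₂ + Real.sin (ω - omegaZero n₁ n₂) • unitSnd n₁ n₂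

/-- The class of admissible densities for the two-sample `t`-statistics. -/
structure TwoSampleRegular (n₁ n₂ : ℕ) (g : Euc (Fin n₁ ⊕ Fin n₂) → ℝ) : Prop where
  density : IsContDensity g
  pos : ∃ r : ℝ, 0 ≤ r ∧ ∃ ω ∈ Set.Icc (-(Real.pi / 2)) (Real.pi / 2),
    0 < g (r • planeDir n₁ n₂ ω)
  integrable : ∃ ε : ℝ, 0 < ε ∧
    ∫⁻ ω in Set.Icc (-(Real.pi / 2)) (Real.pi / 2),
      ENNReal.ofReal (Real.cos ω ^ (n₁ + n₂ - 2)) *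
        ∫⁻ r in Set.Ioi (0 : ℝ), ENNReal.ofReal (r ^ (n₁ + n₂ - 1)) *
          (⨆ ξ : {ξ : Euc (Fin n₁ ⊕ Fin n₂) //
              ξ ∈ (Submodule.span ℝ {unitFst n₁ n₂, unitSnd n₁ n₂})ᗮ ∧ ‖ξ‖ < ε},
            ENNReal.ofReal (g (r • (planeDir n₁ n₂ ω + ξ.1)))) < ⊤

/-- The constant `C(n₁, n₂, α, β)`. -/
def twoSampleC (n₁ n₂ : ℕ) (α β : ℝ) : ℝ :=
  (2 * Real.pi ^ (((n₁ : ℝ) + n₂ - 1) / 2)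
      * (((n₁ : ℝ) - 1) / α) ^ (((n₁ : ℝ) - 1) / 2)
      * (((n₂ : ℝ) - 1) / β) ^ (((n₂ : ℝ) - 1) / 2)
      * (1 / (n₁ : ℝ) + 1 / (n₂ : ℝ)) ^ (((n₁ : ℝ) + n₂ - 2) / 2))
    / (Real.Gamma (((n₁ : ℝ) + n₂ - 1) / 2)
      * ((n₁ : ℝ) + n₂ - 2) ^ (((n₁ : ℝ) + n₂ - 2) / 2))

/-- The functional `K` for the two-sample `t`-statistic with weights `α`, `β`. -/
def twoSampleK (n₁ n₂ : ℕ) (α β : ℝ) (g : Euc (Fin n₁ ⊕ Fin n₂) → ℝ) : ℝ≥0∞ :=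
  ENNReal.ofReal (twoSampleC n₁ n₂ α β) *
    ∫⁻ ω in Set.Icc (-(Real.pi / 2)) (Real.pi / 2),
      ENNReal.ofReal (Real.cos ω ^ (n₁ + n₂ - 2)) *
        ∫⁻ r in Set.Ioi (0 : ℝ), ENNReal.ofReal (r ^ (n₁ + n₂ - 1)) *
          ENNReal.ofReal (g (r • planeDir n₁ n₂ ω))

/-! ### The `F`-statistic -/

/-- The class of admissible densities for the `F`-statistic. -/
structure FRegular (n₁ n₂ : ℕ) (g : Euc (Fin n₁) × Euc (Fin n₂) → ℝ) : Prop where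
  density : IsContDensity g
  pos : ∃ (x : Euc (Fin n₁)) (r : ℝ), 0 < sampleSD x * g (x, r • unitDiag n₂)
  integrable : ∃ ε : ℝ, 0 < ε ∧
    ∫⁻ x : Euc (Fin n₁), ENNReal.ofReal (sampleSD x ^ (n₂ - 1)) *
      ∫⁻ r : ℝ,
        (⨆ ξ : {ξ : Euc (Fin n₂) // ξ ∈ (Submodule.span ℝ {unitDiag n₂})ᗮ ∧ ‖ξ‖ < ε},
          ENNReal.ofReal (g (x, r • unitDiag n₂ + sampleSD x • ξ.1))) < ⊤

/-- The functional `K` for the `F`-statistic. -/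
def fK (n₁ n₂ : ℕ) (g : Euc (Fin n₁) × Euc (Fin n₂) → ℝ) : ℝ≥0∞ :=
  ENNReal.ofReal
      (Real.Gamma (((n₁ : ℝ) - 1) / 2) * (Real.pi * ((n₁ : ℝ) - 1)) ^ (((n₂ : ℝ) - 1) / 2)
        / Real.Gamma (((n₁ : ℝ) + n₂ - 2) / 2)) *
    ∫⁻ x : Euc (Fin n₁), ENNReal.ofReal (sampleSD x ^ (n₂ - 1)) *
      ∫⁻ r : ℝ, ENNReal.ofReal (g (x, r • unitDiag n₂))

/-! ### Comparison of tails -/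

universe v

/-- On the class `𝒢` the functional `K` takes values in `(0, ∞)`, and whenever the random
vector `X` has density `g₀ ∈ 𝒢` under `P₀` (the null hypothesis) and density `g₁ ∈ 𝒢` under `P₁`
(the alternative), then `P₁(T > u) / P₀(T > u) → K g₁ / K g₀` as `u → ∞`. -/
def TailComparison {E : Type} [MeasureSpace E] (T : E → ℝ) (𝒢 : (E → ℝ) → Prop)
    (K : (E → ℝ) → ℝ≥0∞) : Prop :=
  (∀ g, 𝒢 g → 0 < K g ∧ K g < ⊤) ∧
  ∀ g₀ g₁ : E → ℝ, 𝒢 g₀ → 𝒢 g₁ →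
    ∀ (Ω : Type v) [MeasurableSpace Ω] (P₀ P₁ : Measure Ω) (X : Ω → E),
      HasDensity P₀ X g₀ → HasDensity P₁ X g₁ →
        Tendsto (fun u : ℝ => P₁.real {ω | u < T (X ω)} / P₀.real {ω | u < T (X ω)})
          atTop (𝓝 ((K g₁).toReal / (K g₀).toReal))

end TestTails

end

/-!
In linear coordinates `x = L (a, η)` the event `{T > u}` is `{s a / Q η > ψ u}`, where `Q` is
continuous, positive away from the origin and positively homogeneous. With `t = ψ u` and `d` the
dimension of the `η`-space, the substitution `η = (s a / t) ζ` shows that `t ^ d * P (T > u)` is a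
constant multiple of
  `∫ a in {0 < s}, ∫ ζ in {Q < 1}, s a ^ d * g (L (a, (s a / t) • ζ))`.
By condition (b) and dominated convergence this tends to the volume of `{Q < 1}` times
`∫ a in {0 < s}, s a ^ d * g (L (a, 0))`, a constant multiple of `K g`. All the constants are the
same for every `g`, so they cancel in the ratio of two tails.
-/

noncomputable section

namespace TestTails

open Module

section Gauge

variable {F : Type*} [NormedAddCommGroup F] [NormedSpace ℝ F] {Q : F → ℝ}

/-- A gauge: a continuous positively homogeneous function that is positive away from the origin
(convexity and symmetry are not required). The denominators of the test statistics are gauges on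
the space of deviations from the sample means. -/
structure IsGauge (Q : F → ℝ) : Prop where
  continuous : Continuous Q
  map_smul : ∀ (t : ℝ) (η : F), 0 < t → Q (t • η) = t * Q η
  pos : ∀ η, η ≠ 0 → 0 < Q η

namespace IsGauge

theorem map_zero (hQ : IsGauge Q) : Q 0 = 0 := by
  have h := hQ.map_smul 2 0 two_pos
  rw [smul_zero] at h
  linarith

theorem nonneg (hQ : IsGauge Q) (η : F) : 0 ≤ Q η := by
  obtain rfl | hη := eq_or_ne η 0
  · exact hQ.map_zero.ge
  · exact (hQ.pos η hη).le

theorem exists_mul_norm_le [FiniteDimensional ℝ F] (hQ : IsGauge Q) :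
    ∃ c > 0, ∀ η, c * ‖η‖ ≤ Q η := by
  have hsphere : ∀ η ∈ Metric.sphere (0 : F) 1, 0 < Q η := fun η hη =>
    hQ.pos η (ne_zero_of_mem_unit_sphere ⟨η, hη⟩)
  obtain ⟨c, hc, hcQ⟩ :=
    (isCompact_sphere (0 : F) 1).exists_forall_le' hQ.continuous.continuousOn hsphere
  refine ⟨c, hc, fun η => ?_⟩
  obtain rfl | hη := eq_or_ne η 0
  · simp [hQ.map_zero]
  · have hnorm : 0 < ‖η‖ := norm_pos_iff.2 hη
    have hunit := hcQ (‖η‖⁻¹ • η) (by simp [norm_smul, hnorm.ne'])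
    rwa [hQ.map_smul _ _ (inv_pos.2 hnorm), inv_mul_eq_div, le_div_iff₀ hnorm] at hunit

theorem isBounded_preimage_Ioo [FiniteDimensional ℝ F] (hQ : IsGauge Q) :
    Bornology.IsBounded (Q ⁻¹' Set.Ioo 0 1) := by
  obtain ⟨c, hc, hcQ⟩ := hQ.exists_mul_norm_le
  refine isBounded_iff_forall_norm_le.2 ⟨c⁻¹, fun ζ hζ => ?_⟩
  rw [← one_div, le_div_iff₀' hc]
  exact (hcQ ζ).trans hζ.2.le

theorem isOpen_preimage_Ioo (hQ : IsGauge Q) : IsOpen (Q ⁻¹' Set.Ioo 0 1) :=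
  isOpen_Ioo.preimage hQ.continuous

theorem measure_preimage_Ioo_pos [Nontrivial F] [MeasurableSpace F] {ν : Measure F}
    [ν.IsOpenPosMeasure] (hQ : IsGauge Q) :
    0 < ν (Q ⁻¹' Set.Ioo 0 1) := by
  obtain ⟨ζ, hζ⟩ := exists_ne (0 : F)
  have hpos : 0 < Q ζ := hQ.pos ζ hζ
  refine hQ.isOpen_preimage_Ioo.measure_pos ν ⟨(2 * Q ζ)⁻¹ • ζ, ?_⟩
  have hhalf : Q ((2 * Q ζ)⁻¹ • ζ) = 1 / 2 := by
    rw [hQ.map_smul _ _ (by positivity)]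
    field_simp
  rw [Set.mem_preimage, hhalf]
  norm_num

theorem lt_div_smul_iff (hQ : IsGauge Q) {c t : ℝ} (hc : 0 < c) (ht : 0 < t) (ζ : F) :
    t < c / Q ((c / t) • ζ) ↔ ζ ∈ Q ⁻¹' Set.Ioo 0 1 := by
  rw [hQ.map_smul _ _ (by positivity), Set.mem_preimage, Set.mem_Ioo]
  obtain hzero | hpos := (hQ.nonneg ζ).eq_or_lt
  · simp [← hzero, ht.le]
  · rw [lt_div_iff₀ (by positivity), ← mul_assoc, mul_div_cancel₀ c ht.ne',
      mul_lt_iff_lt_one_right hc]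
    exact (and_iff_right hpos).symm

end IsGauge

end Gauge

section AxisIntegral

variable {A F : Type*} [MeasurableSpace A] [NormedAddCommGroup F] [NormedSpace ℝ F]
  {μ : Measure A} {s : A → ℝ} {G : A × F → ℝ≥0∞}

/-- The integral of `G` along the axis `{(a, 0)}`, weighted by the volume factor `s ^ dim F` of the
fibre of `{t < s / Q}`. It is the functional `K` up to a constant. -/
def axisIntegral (μ : Measure A) (s : A → ℝ) (G : A × F → ℝ≥0∞) : ℝ≥0∞ :=
  ∫⁻ a in {a | 0 < s a}, ENNReal.ofReal (s a ^ finrank ℝ F) * G (a, 0) ∂μ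

/-- The analogue of `axisIntegral` for the supremum of `G` over the fibres of the tube
`{(a, η) | ‖η‖ < ε * s a}`: the integral in condition (b) of the theorem. -/
def tubeSupIntegral (μ : Measure A) (s : A → ℝ) (ε : ℝ) (G : A × F → ℝ≥0∞) : ℝ≥0∞ :=
  ∫⁻ a in {a | 0 < s a}, ENNReal.ofReal (s a ^ finrank ℝ F) *
    (⨆ ξ : {ξ : F // ‖ξ‖ < ε}, G (a, s a • ξ.1)) ∂μ

theorem axisIntegral_le_tubeSupIntegral {ε : ℝ} (hε : 0 < ε) :
    axisIntegral μ s G ≤ tubeSupIntegral μ s ε G := by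
  refine lintegral_mono fun a => mul_le_mul_right ?_ _
  exact le_iSup_of_le ⟨0, by simpa using hε⟩ (by simp)

theorem axisIntegral_pos [TopologicalSpace A] [OpensMeasurableSpace A] [μ.IsOpenPosMeasure]
    (hs : Continuous s) (hG : Continuous G) {a : A} (ha : a ∈ closure {a | 0 < s a})
    (hGa : 0 < G (a, 0)) : 0 < axisIntegral μ s G := by
  have hGaxis : Continuous fun a => G (a, 0) := by fun_prop
  have hopen : IsOpen {a | 0 < s a} := isOpen_lt continuous_const hs
  have hopenG : IsOpen {a | 0 < G (a, 0)} := isOpen_lt continuous_const hGaxis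
  have hmeas : Measurable fun a => ENNReal.ofReal (s a ^ finrank ℝ F) * G (a, 0) :=
    (hs.pow _).measurable.ennreal_ofReal.mul hGaxis.measurable
  rw [axisIntegral, setLIntegral_pos_iff hmeas]
  refine (hopenG.inter hopen).measure_pos μ (mem_closure_iff.1 ha _ hopenG hGa)
    |>.trans_le (measure_mono fun b ⟨hGb, hsb⟩ => ⟨?_, hsb⟩)
  exact (ENNReal.mul_pos (ENNReal.ofReal_pos.2 (pow_pos hsb _)).ne' hGb.ne').ne'

theorem measure_mul_axisIntegral [MeasurableSpace F] [SFinite μ] (ν : Measure F) [SFinite ν]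
    (D : Set F) (hs : Measurable s) (hG : Measurable G) :
    ν D * axisIntegral μ s G
      = ∫⁻ p in {a | 0 < s a} ×ˢ D,
          ENNReal.ofReal (s p.1 ^ finrank ℝ F) * G (p.1, 0) ∂μ.prod ν := by
  rw [← Measure.prod_restrict, lintegral_prod _ (by fun_prop)]
  simp only [lintegral_const, Measure.restrict_apply_univ]
  rw [lintegral_mul_const _ (by fun_prop), mul_comm, axisIntegral]

end AxisIntegral

section Ratio

variable {A F : Type*} [MeasurableSpace A] [NormedAddCommGroup F] [NormedSpace ℝ F]
  [FiniteDimensional ℝ F] [MeasurableSpace F] [BorelSpace F]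
  {μ : Measure A} {ν : Measure F} [ν.IsAddHaarMeasure] {s : A → ℝ} {Q : F → ℝ} {G : A × F → ℝ≥0∞}

theorem lintegral_comp_smul (ν : Measure F) [ν.IsAddHaarMeasure] (f : F → ℝ≥0∞) {r : ℝ}
    (hr : 0 < r) :
    ENNReal.ofReal (r ^ finrank ℝ F) * ∫⁻ ζ, f (r • ζ) ∂ν = ∫⁻ η, f η ∂ν := by
  have hpos : 0 < r ^ finrank ℝ F := pow_pos hr _
  rw [← (measurableEmbedding_const_smul₀ hr.ne').lintegral_map, Measure.map_addHaar_smul ν hr.ne',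
    lintegral_smul_measure, abs_of_pos (inv_pos.2 hpos), smul_eq_mul, ← mul_assoc,
    ← ENNReal.ofReal_mul hpos.le, mul_inv_cancel₀ hpos.ne', ENNReal.ofReal_one, one_mul]

theorem IsGauge.setLIntegral_lt_div (hQ : IsGauge Q) (f : F → ℝ≥0∞) {c t : ℝ} (hc : 0 < c)
    (ht : 0 < t) :
    ENNReal.ofReal (t ^ finrank ℝ F) * ∫⁻ η in {η | t < c / Q η}, f η ∂ν
      = ENNReal.ofReal (c ^ finrank ℝ F) *
          ∫⁻ ζ in Q ⁻¹' Set.Ioo 0 1, f ((c / t) • ζ) ∂ν := by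
  have hevent : MeasurableSet {η | t < c / Q η} :=
    measurableSet_lt measurable_const (measurable_const.div hQ.continuous.measurable)
  have hpow : ENNReal.ofReal (t ^ finrank ℝ F) * ENNReal.ofReal ((c / t) ^ finrank ℝ F)
      = ENNReal.ofReal (c ^ finrank ℝ F) := by
    rw [← ENNReal.ofReal_mul (by positivity), ← mul_pow, mul_div_cancel₀ c ht.ne']
  rw [← lintegral_indicator hevent, ← lintegral_comp_smul ν _ (div_pos hc ht), ← mul_assoc, hpow,
    ← lintegral_indicator hQ.isOpen_preimage_Ioo.measurableSet]
  congr 2 with ζ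
  classical
  simp only [Set.indicator_apply, Set.mem_ofPred_eq, hQ.lt_div_smul_iff hc ht]

theorem IsGauge.lintegral_lt_div [SFinite μ] (hQ : IsGauge Q) (hs : Measurable s)
    (hG : Measurable G) {t : ℝ} (ht : 0 < t) :
    ENNReal.ofReal (t ^ finrank ℝ F) * ∫⁻ p in {p | t < s p.1 / Q p.2}, G p ∂μ.prod ν
      = ∫⁻ p in {a | 0 < s a} ×ˢ (Q ⁻¹' Set.Ioo 0 1),
          ENNReal.ofReal (s p.1 ^ finrank ℝ F) * G (p.1, (s p.1 / t) • p.2) ∂μ.prod ν := by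
  have hQm : Measurable Q := hQ.continuous.measurable
  have hevent : MeasurableSet {p : A × F | t < s p.1 / Q p.2} :=
    measurableSet_lt (by fun_prop) (by fun_prop)
  have hfiber (a : A) : ENNReal.ofReal (t ^ finrank ℝ F) *
        ∫⁻ η, {p : A × F | t < s p.1 / Q p.2}.indicator G (a, η) ∂ν
      = {a | 0 < s a}.indicator (fun a => ∫⁻ ζ in Q ⁻¹' Set.Ioo 0 1,
          ENNReal.ofReal (s a ^ finrank ℝ F) * G (a, (s a / t) • ζ) ∂ν) a := by
    have hind : ∫⁻ η, {p : A × F | t < s p.1 / Q p.2}.indicator G (a, η) ∂ν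
        = ∫⁻ η in {η | t < s a / Q η}, G (a, η) ∂ν :=
      lintegral_indicator (measurable_prodMk_left hevent) fun η => G (a, η)
    rw [hind]
    obtain ha | ha := lt_or_ge 0 (s a)
    · rw [Set.indicator_of_mem (by exact ha), hQ.setLIntegral_lt_div _ ha ht,
        lintegral_const_mul' _ _ ENNReal.ofReal_ne_top]
    · have hempty : {η | t < s a / Q η} = ∅ := Set.eq_empty_of_forall_notMem fun η hη =>
        (ht.trans hη).not_ge (div_nonpos_of_nonpos_of_nonneg ha (hQ.nonneg η))
      rw [Set.indicator_of_notMem (by exact ha.not_gt), hempty, setLIntegral_empty, mul_zero]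
  rw [← lintegral_indicator hevent, lintegral_prod _ (hG.indicator hevent).aemeasurable,
    ← lintegral_const_mul' _ _ ENNReal.ofReal_ne_top, lintegral_congr hfiber,
    lintegral_indicator (measurableSet_lt measurable_const hs), ← Measure.prod_restrict,
    lintegral_prod _ (by fun_prop)]

theorem tendsto_setLIntegral_comp_smul_div [TopologicalSpace A] [OpensMeasurableSpace A] [SFinite μ]
    {D : Set F} (hD : MeasurableSet D) (hbdd : Bornology.IsBounded D) (hs : Continuous s)
    (hG : Continuous G) {ε : ℝ} (hε : 0 < ε) (hfin : tubeSupIntegral μ s ε G ≠ ⊤) :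
    Tendsto (fun t : ℝ => ∫⁻ p in {a | 0 < s a} ×ˢ D,
        ENNReal.ofReal (s p.1 ^ finrank ℝ F) * G (p.1, (s p.1 / t) • p.2) ∂μ.prod ν) atTop
      (𝓝 (ν D * axisIntegral μ s G)) := by
  obtain ⟨R, hR⟩ := isBounded_iff_forall_norm_le.1 hbdd
  have hGm : Measurable G := hG.measurable
  have hsm : Measurable s := hs.measurable
  have hνD : ν D ≠ ⊤ := hbdd.measure_lt_top.ne
  have hsmall : ∀ᶠ t : ℝ in atTop, 0 < t ∧ R < ε * t :=
    (eventually_gt_atTop 0).and ((tendsto_id.const_mul_atTop hε).eventually_gt_atTop R)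
  rw [measure_mul_axisIntegral ν D hsm hGm]
  refine tendsto_lintegral_filter_of_dominated_convergence
    (fun p => ENNReal.ofReal (s p.1 ^ finrank ℝ F) *
      ⨆ ξ : {ξ : F // ‖ξ‖ < ε}, G (p.1, s p.1 • ξ.1))
    (Eventually.of_forall fun t => by fun_prop) ?_ ?_ (Eventually.of_forall fun p => ?_)
  · filter_upwards [hsmall] with t ⟨ht, hRt⟩
    have hdom : MeasurableSet ({a | 0 < s a} ×ˢ D) :=
      (measurableSet_lt measurable_const hsm).prod hD
    refine ae_restrict_of_forall_mem hdom fun p hp => ?_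
    have hnorm : ‖t⁻¹ • p.2‖ < ε := by
      rw [norm_smul, Real.norm_of_nonneg (inv_pos.2 ht).le, inv_mul_lt_iff₀ ht, mul_comm]
      exact (hR _ hp.2).trans_lt hRt
    gcongr
    exact le_iSup_of_le ⟨t⁻¹ • p.2, hnorm⟩ (by rw [smul_smul, div_eq_mul_inv])
  · rw [← Measure.prod_restrict]
    refine ((lintegral_prod_le _).trans_lt ?_).ne
    simp only [lintegral_const, Measure.restrict_apply_univ]
    rw [lintegral_mul_const' _ _ hνD]
    exact ENNReal.mul_lt_top hfin.lt_top hνD.lt_top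
  · have hcont : Continuous fun δ : ℝ => G (p.1, δ • p.2) := by fun_prop
    have hzero : Tendsto (fun t : ℝ => s p.1 / t) atTop (𝓝 0) :=
      tendsto_const_nhds.div_atTop tendsto_id
    have htendsto := (hcont.tendsto 0).comp hzero
    rw [zero_smul] at htendsto
    exact ENNReal.Tendsto.const_mul htendsto (Or.inr ENNReal.ofReal_ne_top)

theorem IsGauge.tendsto_lintegral_lt_div [TopologicalSpace A] [OpensMeasurableSpace A] [SFinite μ]
    (hQ : IsGauge Q) (hs : Continuous s) (hG : Continuous G) {ε : ℝ} (hε : 0 < ε)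
    (hfin : tubeSupIntegral μ s ε G ≠ ⊤) :
    Tendsto (fun t : ℝ => ENNReal.ofReal (t ^ finrank ℝ F) *
        ∫⁻ p in {p | t < s p.1 / Q p.2}, G p ∂μ.prod ν) atTop
      (𝓝 (ν (Q ⁻¹' Set.Ioo 0 1) * axisIntegral μ s G)) := by
  refine (tendsto_setLIntegral_comp_smul_div hQ.isOpen_preimage_Ioo.measurableSet
    hQ.isBounded_preimage_Ioo hs hG hε hfin).congr' ?_
  filter_upwards [eventually_gt_atTop 0] with t ht
  exact (hQ.lintegral_lt_div hs.measurable hG.measurable ht).symm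

end Ratio

section Density

theorem HasDensity.measure_setOf_lt {Ω E : Type*} [MeasurableSpace Ω] [MeasureSpace E]
    {P : Measure Ω} {X : Ω → E} {g T : E → ℝ} (h : HasDensity P X g) (hT : Measurable T) (u : ℝ) :
    P {ω | u < T (X ω)} = ∫⁻ x in {x | u < T x}, ENNReal.ofReal (g x) := by
  have hevent : MeasurableSet {x | u < T x} := measurableSet_lt measurable_const hT
  rw [← withDensity_apply _ hevent, ← h.map_eq, Measure.map_apply_of_aemeasurable h.aemeasurable
    hevent]
  rfl

end Density

section RatioStatistic

variable {A F : Type*} {E : Type} [NormedAddCommGroup A] [NormedSpace ℝ A] [MeasurableSpace A]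
  [NormedAddCommGroup F] [NormedSpace ℝ F] [NormedAddCommGroup E] [NormedSpace ℝ E]
  {μ : Measure A} {L : (A × F) ≃L[ℝ] E} {s : A → ℝ} {Q : F → ℝ} {ψ : ℝ → ℝ} {T g : E → ℝ}

/-- Conditions (a) and (b) of the theorem in the linear coordinates `x = L (a, η)`. -/
structure IsTubeRegular (μ : Measure A) (L : (A × F) ≃L[ℝ] E) (s : A → ℝ) (g : E → ℝ) :
    Prop where
  continuous : Continuous g
  pos : ∃ a ∈ closure {a | 0 < s a}, 0 < g (L (a, 0))
  integrable : ∃ ε > 0, tubeSupIntegral μ s ε (fun p => ENNReal.ofReal (g (L p))) < ⊤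

namespace IsTubeRegular

theorem continuous_ofReal_comp (h : IsTubeRegular μ L s g) :
    Continuous fun p => ENNReal.ofReal (g (L p)) :=
  ENNReal.continuous_ofReal.comp (h.continuous.comp L.continuous)

theorem axisIntegral_lt_top (h : IsTubeRegular μ L s g) :
    axisIntegral μ s (fun p => ENNReal.ofReal (g (L p))) < ⊤ := by
  obtain ⟨ε, hε, hfin⟩ := h.integrable
  exact (axisIntegral_le_tubeSupIntegral hε).trans_lt hfin

theorem axisIntegral_pos [BorelSpace A] [μ.IsOpenPosMeasure] (h : IsTubeRegular μ L s g)
    (hs : Continuous s) :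
    0 < axisIntegral μ s (fun p => ENNReal.ofReal (g (L p))) := by
  obtain ⟨a, ha, hga⟩ := h.pos
  exact TestTails.axisIntegral_pos hs h.continuous_ofReal_comp ha (ENNReal.ofReal_pos.2 hga)

end IsTubeRegular

/-- In the linear coordinates `x = L (a, η)` the upper tails of `T` are those of the ratio
`s a / Q η`. The function `ψ` rescales the thresholds: the tail `{u < T}` is
`{ψ u < s a / Q η}`. -/
structure IsRatioStatistic [MeasurableSpace E] (T : E → ℝ) (L : (A × F) ≃L[ℝ] E) (s : A → ℝ)
    (Q : F → ℝ) (ψ : ℝ → ℝ) : Prop where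
  measurable : Measurable T
  continuous : Continuous s
  isGauge : IsGauge Q
  tendsto : Tendsto ψ atTop atTop
  lt_iff : ∀ᶠ u in atTop, ∀ a η, u < T (L (a, η)) ↔ ψ u < s a / Q η

variable [FiniteDimensional ℝ A] [BorelSpace A] [FiniteDimensional ℝ F]
  [FiniteDimensional ℝ E] [MeasureSpace E] [BorelSpace E] [(volume : Measure E).IsAddHaarMeasure]

theorem exists_volume_eq_smul_map_prod [MeasurableSpace F] [BorelSpace F] (μ : Measure A)
    [μ.IsAddHaarMeasure] (ν : Measure F) [ν.IsAddHaarMeasure] (L : (A × F) ≃L[ℝ] E) :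
    ∃ c : ℝ≥0∞, c ≠ 0 ∧ c ≠ ⊤ ∧ (volume : Measure E) = c • (μ.prod ν).map L := by
  have hHaar : ((μ.prod ν).map L).IsAddHaarMeasure := L.isAddHaarMeasure_map _
  refine ⟨(volume : Measure E).addHaarScalarFactor ((μ.prod ν).map L), ?_, ENNReal.coe_ne_top,
    Measure.isAddLeftInvariant_eq_smul _ _⟩
  exact_mod_cast (Measure.addHaarScalarFactor_pos_of_isAddHaarMeasure _ _).ne'

namespace IsRatioStatistic

theorem exists_tendsto_tail [Nontrivial F] (hT : IsRatioStatistic T L s Q ψ) (μ : Measure A)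
    [μ.IsAddHaarMeasure] :
    ∃ κ : ℝ≥0∞, κ ≠ 0 ∧ κ ≠ ⊤ ∧ ∀ g, IsTubeRegular μ L s g →
      Tendsto (fun u => ENNReal.ofReal (ψ u ^ finrank ℝ F) *
          ∫⁻ x in {x | u < T x}, ENNReal.ofReal (g x)) atTop
        (𝓝 (κ * axisIntegral μ s fun p => ENNReal.ofReal (g (L p)))) := by
  borelize F
  let ν : Measure F := Measure.addHaar
  obtain ⟨c, hc, hctop, hvol⟩ := exists_volume_eq_smul_map_prod μ ν L
  refine ⟨c * ν (Q ⁻¹' Set.Ioo 0 1), mul_ne_zero hc hT.isGauge.measure_preimage_Ioo_pos.ne',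
    ENNReal.mul_ne_top hctop hT.isGauge.isBounded_preimage_Ioo.measure_lt_top.ne, fun g hg => ?_⟩
  obtain ⟨ε, hε, hfin⟩ := hg.integrable
  have hlim := (hT.isGauge.tendsto_lintegral_lt_div (ν := ν) hT.continuous
    hg.continuous_ofReal_comp hε hfin.ne).comp hT.tendsto
  rw [mul_assoc]
  refine (ENNReal.Tendsto.const_mul hlim (Or.inr hctop)).congr' ?_
  filter_upwards [hT.lt_iff] with u hu
  have hevent : MeasurableSet {x | u < T x} := measurableSet_lt measurable_const hT.measurable
  have hpreimage : L ⁻¹' {x | u < T x} = {p | ψ u < s p.1 / Q p.2} :=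
    Set.ext fun p => hu p.1 p.2
  rw [hvol, Measure.restrict_smul, lintegral_smul_measure, smul_eq_mul, mul_left_comm,
    setLIntegral_map hevent hg.continuous.measurable.ennreal_ofReal L.continuous.measurable,
    hpreimage]
  rfl

theorem tailComparison [Nontrivial F] [μ.IsAddHaarMeasure] (hT : IsRatioStatistic T L s Q ψ)
    {𝒢 : (E → ℝ) → Prop} {K : (E → ℝ) → ℝ≥0∞} {C : ℝ≥0∞} (hC : C ≠ 0) (hCtop : C ≠ ⊤)
    (h𝒢 : ∀ g, 𝒢 g → IsTubeRegular μ L s g)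
    (hK : ∀ g, 𝒢 g → K g = C * axisIntegral μ s fun p => ENNReal.ofReal (g (L p))) :
    TailComparison T 𝒢 K := by
  refine ⟨fun g hg => ?_, fun g₀ g₁ h₀ h₁ Ω _ P₀ P₁ X hX₀ hX₁ => ?_⟩
  · rw [hK g hg]
    exact ⟨ENNReal.mul_pos hC ((h𝒢 g hg).axisIntegral_pos hT.continuous).ne',
      ENNReal.mul_lt_top hCtop.lt_top (h𝒢 g hg).axisIntegral_lt_top⟩
  obtain ⟨κ, hκ, hκtop, hlim⟩ := hT.exists_tendsto_tail μ
  set J : (E → ℝ) → ℝ≥0∞ := fun g => axisIntegral μ s fun p => ENNReal.ofReal (g (L p))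
  have hJ₀ : J g₀ ≠ 0 := ((h𝒢 g₀ h₀).axisIntegral_pos hT.continuous).ne'
  have hJ₁ : J g₁ ≠ ⊤ := (h𝒢 g₁ h₁).axisIntegral_lt_top.ne
  have hquot : Tendsto (fun u => P₁ {ω | u < T (X ω)} / P₀ {ω | u < T (X ω)}) atTop
      (𝓝 (J g₁ / J g₀)) := by
    have hscaled := ENNReal.Tendsto.div (hlim g₁ (h𝒢 g₁ h₁)) (Or.inr (mul_ne_zero hκ hJ₀))
      (hlim g₀ (h𝒢 g₀ h₀)) (Or.inr (ENNReal.mul_ne_top hκtop hJ₁))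
    rw [ENNReal.mul_div_mul_left _ _ hκ hκtop] at hscaled
    refine hscaled.congr' ?_
    filter_upwards [hT.tendsto.eventually_gt_atTop 0] with u hu
    rw [← hX₀.measure_setOf_lt hT.measurable, ← hX₁.measure_setOf_lt hT.measurable,
      ENNReal.mul_div_mul_left _ _ (ENNReal.ofReal_pos.2 (pow_pos hu _)).ne'
        ENNReal.ofReal_ne_top]
  rw [hK g₀ h₀, hK g₁ h₁, ← ENNReal.toReal_div, ENNReal.mul_div_mul_left _ _ hC hCtop]
  refine ((ENNReal.tendsto_toReal (ENNReal.div_ne_top hJ₁ hJ₀)).comp hquot).congr fun u => ?_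
  exact ENNReal.toReal_div _ _

end IsRatioStatistic

end RatioStatistic

section OrthogonalChart

variable {A E : Type*} [NormedAddCommGroup A] [NormedSpace ℝ A] [FiniteDimensional ℝ A]
  [NormedAddCommGroup E] [InnerProductSpace ℝ E] [FiniteDimensional ℝ E] {V : Submodule ℝ E}
  {B : A →ₗ[ℝ] E}

/-- Linear coordinates `x = B a + η` along and orthogonal to a subspace `V`, which is parametrized
by the injective linear map `B`. -/
def orthogonalChart (B : A →ₗ[ℝ] E) (hB : Function.Injective B) (hV : LinearMap.range B = V) :
    (A × Vᗮ) ≃L[ℝ] E :=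
  (((LinearEquiv.ofInjective B hB).trans (LinearEquiv.ofEq _ _ hV)).prodCongr
    (LinearEquiv.refl ℝ Vᗮ) |>.trans
      (Submodule.prodEquivOfIsCompl V Vᗮ V.isCompl_orthogonal)).toContinuousLinearEquiv

theorem orthogonalChart_apply (hB : Function.Injective B) (hV : LinearMap.range B = V) (a : A)
    (η : Vᗮ) : orthogonalChart B hB hV (a, η) = B a + η := by
  simp [orthogonalChart, Submodule.coe_prodEquivOfIsCompl']

theorem finrank_orthogonal_range (hB : Function.Injective B) (hV : LinearMap.range B = V) :
    finrank ℝ Vᗮ = finrank ℝ E - finrank ℝ A := by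
  have h := (orthogonalChart B hB hV).toLinearEquiv.finrank_eq
  rw [finrank_prod] at h
  omega

end OrthogonalChart

theorem iSup_submodule_norm_lt {E : Type*} [NormedAddCommGroup E] [NormedSpace ℝ E]
    (V : Submodule ℝ E) (ε : ℝ) (f : E → ℝ≥0∞) :
    ⨆ ξ : {ξ : V // ‖ξ‖ < ε}, f ξ.1 = ⨆ ξ : {ξ : E // ξ ∈ V ∧ ‖ξ‖ < ε}, f ξ.1 := by
  simp only [iSup_subtype, iSup_and, Submodule.coe_norm]

section SampleMoments

variable {m : ℕ}

theorem continuous_sampleMean : Continuous (sampleMean (m := m)) := by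
  unfold sampleMean
  fun_prop

theorem continuous_sampleVar : Continuous (sampleVar (m := m)) := by
  have := continuous_sampleMean (m := m)
  unfold sampleVar
  fun_prop

theorem continuous_sampleSD : Continuous (sampleSD (m := m)) :=
  continuous_sampleVar.sqrt

theorem sampleMean_smul (t : ℝ) (x : Fin m → ℝ) : sampleMean (t • x) = t * sampleMean x := by
  simp [sampleMean, ← Finset.mul_sum, mul_div_assoc]

theorem sampleVar_smul (t : ℝ) (x : Fin m → ℝ) : sampleVar (t • x) = t ^ 2 * sampleVar x := by
  simp [sampleVar, sampleMean_smul, ← mul_sub, mul_pow, ← Finset.mul_sum, mul_div_assoc]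

theorem sampleSD_smul {t : ℝ} (ht : 0 ≤ t) (x : Fin m → ℝ) :
    sampleSD (t • x) = t * sampleSD x := by
  rw [sampleSD, sampleVar_smul, Real.sqrt_mul (sq_nonneg t), Real.sqrt_sq ht, sampleSD]

theorem sampleMean_const_add (hm : m ≠ 0) (c : ℝ) (x : Fin m → ℝ) :
    sampleMean (fun i => c + x i) = c + sampleMean x := by
  have hm' : (m : ℝ) ≠ 0 := Nat.cast_ne_zero.2 hm
  simp [sampleMean, Finset.sum_add_distrib, add_div, mul_div_cancel_left₀ c hm']

theorem sampleVar_const_add (c : ℝ) (x : Fin m → ℝ) :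
    sampleVar (fun i => c + x i) = sampleVar x := by
  obtain rfl | hm := eq_or_ne m 0
  · simp [sampleVar]
  · simp [sampleVar, sampleMean_const_add hm]

theorem sampleVar_nonneg (x : Fin m → ℝ) : 0 ≤ sampleVar x := by
  obtain rfl | hm := Nat.eq_zero_or_pos m
  · simp [sampleVar]
  · have hm' : (1 : ℝ) ≤ m := Nat.one_le_cast.2 hm
    exact div_nonneg (Finset.sum_nonneg fun i _ => sq_nonneg _) (sub_nonneg.2 hm')

theorem sampleVar_pos (hm : 2 ≤ m) {x : Fin m → ℝ} (hmean : sampleMean x = 0) (hx : x ≠ 0) :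
    0 < sampleVar x := by
  obtain ⟨i, hi⟩ := Function.ne_iff.1 hx
  have hm' : (1 : ℝ) < m := by exact_mod_cast hm
  simp only [sampleVar, hmean, sub_zero]
  refine div_pos (Finset.sum_pos' (fun j _ => sq_nonneg _) ⟨i, Finset.mem_univ i, ?_⟩)
    (sub_pos.2 hm')
  exact sq_pos_of_ne_zero hi

theorem sampleSD_pos (hm : 2 ≤ m) {x : Fin m → ℝ} (hmean : sampleMean x = 0) (hx : x ≠ 0) :
    0 < sampleSD x :=
  Real.sqrt_pos.2 (sampleVar_pos hm hmean hx)

theorem inner_unitDiag (x : Euc (Fin m)) :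
    inner ℝ (unitDiag m) x = √m * sampleMean x := by
  have hsqrt : √(m : ℝ) / m = (√m)⁻¹ := Real.sqrt_div_self'.trans (one_div _)
  simp only [unitDiag, PiLp.inner_apply, RCLike.inner_apply, conj_trivial, ← Finset.sum_mul,
    sampleMean, one_div, ← hsqrt]
  ring

theorem sampleMean_eq_zero_of_mem_orthogonal (hm : m ≠ 0) {x : Euc (Fin m)}
    (hx : x ∈ (ℝ ∙ unitDiag m)ᗮ) : sampleMean x = 0 := by
  rw [Submodule.mem_orthogonal_singleton_iff_inner_right, inner_unitDiag] at hx
  exact (mul_eq_zero.1 hx).resolve_left (by positivity)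

theorem sampleVar_smul_unitDiag_add (a : ℝ) (x : Euc (Fin m)) :
    sampleVar (a • unitDiag m + x) = sampleVar x := by
  rw [← sampleVar_const_add (a * (1 / √m)) x]
  rfl

theorem norm_unitDiag (hm : m ≠ 0) : ‖unitDiag m‖ = 1 := by
  have hm' : (m : ℝ) ≠ 0 := Nat.cast_ne_zero.2 hm
  simp [EuclideanSpace.norm_eq, unitDiag, hm']

theorem unitDiag_ne_zero (hm : m ≠ 0) : unitDiag m ≠ 0 :=
  norm_ne_zero_iff.1 (by rw [norm_unitDiag hm]; exact one_ne_zero)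

theorem isGauge_sampleSD (hm : 2 ≤ m) :
    IsGauge fun η : (ℝ ∙ unitDiag m)ᗮ => sampleSD (η : Euc (Fin m)) where
  continuous := continuous_sampleSD.comp (by fun_prop)
  map_smul t η ht := sampleSD_smul ht.le _
  pos η hη := sampleSD_pos hm (sampleMean_eq_zero_of_mem_orthogonal (by omega) η.2) fun h =>
    hη (Subtype.ext (PiLp.ext (congrFun h)))

end SampleMoments

section OneSample

variable {m n : ℕ}

/-- Linear coordinates `x = a I + η` along and orthogonal to the diagonal, where `I` is
`unitDiag m`. -/
def diagChart (hm : m ≠ 0) : (ℝ × (ℝ ∙ unitDiag m)ᗮ) ≃L[ℝ] Euc (Fin m) :=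
  orthogonalChart (LinearMap.toSpanSingleton ℝ _ (unitDiag m))
    (smul_left_injective ℝ (unitDiag_ne_zero hm))
    (LinearMap.range_toSpanSingleton (unitDiag m))

theorem diagChart_apply (hm : m ≠ 0) (a : ℝ) (η : (ℝ ∙ unitDiag m)ᗮ) :
    diagChart hm (a, η) = a • unitDiag m + (η : Euc (Fin m)) :=
  orthogonalChart_apply _ _ a η

theorem finrank_orthogonal_unitDiag (hm : m ≠ 0) : finrank ℝ (ℝ ∙ unitDiag m)ᗮ = m - 1 := by
  have h := finrank_orthogonal_range (B := LinearMap.toSpanSingleton ℝ _ (unitDiag m))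
    (smul_left_injective ℝ (unitDiag_ne_zero hm)) (LinearMap.range_toSpanSingleton (unitDiag m))
  rwa [finrank_self, finrank_euclideanSpace_fin] at h

theorem nontrivial_orthogonal_unitDiag (hm : 2 ≤ m) : Nontrivial (ℝ ∙ unitDiag m)ᗮ := by
  have hrank := finrank_orthogonal_unitDiag (m := m) (by omega)
  exact nontrivial_of_finrank_pos (R := ℝ) (by omega)

theorem oneSampleT_smul_unitDiag_add (hn : n ≠ 0) (a : ℝ) {η : Euc (Fin n)}
    (hη : η ∈ (ℝ ∙ unitDiag n)ᗮ) : oneSampleT n (a • unitDiag n + η) = a / sampleSD η := by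
  have hinner : inner ℝ (unitDiag n) (a • unitDiag n + η) = a := by
    rw [inner_add_right, inner_smul_right, real_inner_self_eq_norm_sq, norm_unitDiag hn,
      (Submodule.mem_orthogonal_singleton_iff_inner_right).1 hη]
    ring
  rw [oneSampleT, ← mul_div_assoc, ← inner_unitDiag, hinner, sampleSD, sampleVar_smul_unitDiag_add,
    ← sampleSD]

theorem measurable_oneSampleT (n : ℕ) : Measurable (oneSampleT n) := by
  have hmean := continuous_sampleMean (m := n)
  have hSD := continuous_sampleSD (m := n)
  exact measurable_const.mul ((hmean.comp (by fun_prop)).measurable.div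
    (hSD.comp (by fun_prop)).measurable)

theorem isRatioStatistic_oneSampleT (hn : 2 ≤ n) :
    IsRatioStatistic (oneSampleT n) (diagChart (by omega)) id (fun η => sampleSD (η : Euc (Fin n)))
      id where
  measurable := measurable_oneSampleT n
  continuous := continuous_id
  isGauge := isGauge_sampleSD hn
  tendsto := tendsto_id
  lt_iff := Eventually.of_forall fun u a η => by
    rw [diagChart_apply, oneSampleT_smul_unitDiag_add (by omega) a η.2, id, id]

theorem OneSampleRegular.isTubeRegular (hn : n ≠ 0) {g : Euc (Fin n) → ℝ}
    (hg : OneSampleRegular n g) : IsTubeRegular volume (diagChart hn) id g where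
  continuous := hg.density.continuous
  pos := by
    obtain ⟨x, hx, hgx⟩ := hg.pos
    refine ⟨x, ?_, by simpa [diagChart_apply] using hgx⟩
    exact (closure_Ioi (0 : ℝ)).symm ▸ hx
  integrable := by
    obtain ⟨ε, hε, hfin⟩ := hg.integrable
    refine ⟨ε, hε, lt_of_eq_of_lt ?_ hfin⟩
    simp only [tubeSupIntegral, finrank_orthogonal_unitDiag hn, diagChart_apply,
      Submodule.coe_smul, ← smul_add, id]
    refine lintegral_congr fun r => congrArg _ ?_
    exact iSup_submodule_norm_lt _ ε fun ξ => ENNReal.ofReal (g (r • (unitDiag n + ξ)))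

theorem oneSampleK_eq_mul_axisIntegral (hn : n ≠ 0) (g : Euc (Fin n) → ℝ) :
    oneSampleK n g = ENNReal.ofReal (2 * Real.pi ^ ((n : ℝ) / 2) / Real.Gamma ((n : ℝ) / 2)) *
      axisIntegral volume id fun p => ENNReal.ofReal (g (diagChart hn p)) := by
  simp only [oneSampleK, axisIntegral, finrank_orthogonal_unitDiag hn, diagChart_apply,
    Submodule.coe_zero, add_zero, id]
  rfl

theorem tailComparison_oneSample (hn : 2 ≤ n) :
    TailComparison (oneSampleT n) (OneSampleRegular n) (oneSampleK n) := by
  have hn₀ : n ≠ 0 := by omega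
  have := nontrivial_orthogonal_unitDiag hn
  have hC : 0 < 2 * Real.pi ^ ((n : ℝ) / 2) / Real.Gamma ((n : ℝ) / 2) :=
    div_pos (by positivity) (Real.Gamma_pos_of_pos (by positivity))
  exact (isRatioStatistic_oneSampleT hn).tailComparison (ENNReal.ofReal_pos.2 hC).ne'
    ENNReal.ofReal_ne_top (fun g hg => hg.isTubeRegular hn₀)
    fun g _ => oneSampleK_eq_mul_axisIntegral hn₀ g

end OneSample

section Polar

theorem cos_pos_iff_mem_Ioo {ω : ℝ} (hω : ω ∈ Set.Ioo (-Real.pi) Real.pi) :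
    0 < Real.cos ω ↔ ω ∈ Set.Ioo (-(Real.pi / 2)) (Real.pi / 2) := by
  refine ⟨fun hcos => abs_lt.1 ?_, Real.cos_pos_of_mem_Ioo⟩
  by_contra! habs
  have hle := Real.cos_nonpos_of_pi_div_two_le_of_le habs
    (by linarith [abs_lt.2 hω, Real.pi_pos])
  rw [Real.cos_abs] at hle
  exact hle.not_gt hcos

theorem polarCoord_symm_preimage_halfPlane :
    polarCoord.symm ⁻¹' {y : ℝ × ℝ | 0 < y.1} ∩ polarCoord.target
      = Set.Ioi 0 ×ˢ Set.Ioo (-(Real.pi / 2)) (Real.pi / 2) := by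
  ext ⟨r, ω⟩
  simp only [polarCoord_target, Set.mem_inter_iff, Set.mem_preimage, Set.mem_ofPred_eq,
    polarCoord_symm_apply, Set.mem_prod, Set.mem_Ioi]
  constructor
  · rintro ⟨hpos, hr, hω⟩
    exact ⟨hr, (cos_pos_iff_mem_Ioo hω).1 (pos_of_mul_pos_right hpos hr.le)⟩
  · rintro ⟨hr, hω⟩
    refine ⟨mul_pos hr (Real.cos_pos_of_mem_Ioo hω), hr, Set.Ioo_subset_Ioo ?_ ?_ hω⟩ <;>
      linarith [Real.pi_pos]

theorem lintegral_halfPlane {f : ℝ × ℝ → ℝ≥0∞} (hf : Measurable f) :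
    ∫⁻ y in {y : ℝ × ℝ | 0 < y.1}, f y
      = ∫⁻ ω in Set.Icc (-(Real.pi / 2)) (Real.pi / 2), ∫⁻ r in Set.Ioi (0 : ℝ),
          ENNReal.ofReal r * f (r * Real.cos ω, r * Real.sin ω) := by
  have hH : MeasurableSet {y : ℝ × ℝ | 0 < y.1} := measurableSet_lt measurable_const measurable_fst
  have hsymm : Measurable polarCoord.symm := continuous_polarCoord_symm.measurable
  have hint : Measurable fun p : ℝ × ℝ =>
    ENNReal.ofReal p.1 * f (p.1 * Real.cos p.2, p.1 * Real.sin p.2) := by fun_prop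
  calc ∫⁻ y in {y : ℝ × ℝ | 0 < y.1}, f y
      = ∫⁻ p in polarCoord.target, (polarCoord.symm ⁻¹' {y : ℝ × ℝ | 0 < y.1}).indicator
          (fun p => ENNReal.ofReal p.1 * f (p.1 * Real.cos p.2, p.1 * Real.sin p.2)) p := by
        rw [← lintegral_indicator hH, ← lintegral_comp_polarCoord_symm]
        refine lintegral_congr fun p => ?_
        rw [smul_eq_mul, ← Set.indicator_const_mul]
        rfl
    _ = ∫⁻ p in Set.Ioi 0 ×ˢ Set.Ioo (-(Real.pi / 2)) (Real.pi / 2),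
          ENNReal.ofReal p.1 * f (p.1 * Real.cos p.2, p.1 * Real.sin p.2) := by
        rw [setLIntegral_indicator (hsymm hH), polarCoord_symm_preimage_halfPlane]
    _ = _ := by
        rw [Measure.volume_eq_prod, setLIntegral_prod_symm _ hint.aemeasurable,
          setLIntegral_congr Ioo_ae_eq_Icc]

theorem lintegral_halfPlane_pow_mul (k : ℕ) {f : ℝ × ℝ → ℝ≥0∞} (hf : Measurable f) :
    ∫⁻ y in {y : ℝ × ℝ | 0 < y.1}, ENNReal.ofReal (y.1 ^ k) * f y
      = ∫⁻ ω in Set.Icc (-(Real.pi / 2)) (Real.pi / 2), ENNReal.ofReal (Real.cos ω ^ k) *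
          ∫⁻ r in Set.Ioi (0 : ℝ), ENNReal.ofReal (r ^ (k + 1)) *
            f (r * Real.cos ω, r * Real.sin ω) := by
  rw [lintegral_halfPlane (by fun_prop)]
  refine setLIntegral_congr_fun measurableSet_Icc fun ω hω => ?_
  rw [← lintegral_const_mul' _ _ ENNReal.ofReal_ne_top]
  refine setLIntegral_congr_fun measurableSet_Ioi fun r (hr : 0 < r) => ?_
  have hcos : 0 ≤ Real.cos ω ^ k := pow_nonneg (Real.cos_nonneg_of_mem_Icc hω) k
  have hweight : r * (r * Real.cos ω) ^ k = Real.cos ω ^ k * r ^ (k + 1) := by ring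
  simp only [← mul_assoc, ← ENNReal.ofReal_mul hr.le, ← ENNReal.ofReal_mul hcos, hweight]

end Polar

section TwoSample

variable {n₁ n₂ : ℕ}

theorem inner_unitFst (x : Euc (Fin n₁ ⊕ Fin n₂)) :
    inner ℝ (unitFst n₁ n₂) x = √n₁ * sampleMean (fstSample x) := by
  have h := inner_unitDiag (WithLp.toLp 2 (fstSample x))
  simpa [unitFst, unitDiag, fstSample, PiLp.inner_apply] using h

theorem inner_unitSnd (x : Euc (Fin n₁ ⊕ Fin n₂)) :
    inner ℝ (unitSnd n₁ n₂) x = √n₂ * sampleMean (sndSample x) := by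
  have h := inner_unitDiag (WithLp.toLp 2 (sndSample x))
  simpa [unitSnd, unitDiag, sndSample, PiLp.inner_apply] using h

theorem norm_unitFst (hn₁ : n₁ ≠ 0) : ‖unitFst n₁ n₂‖ = 1 := by
  have hn₁' : (n₁ : ℝ) ≠ 0 := Nat.cast_ne_zero.2 hn₁
  simp [EuclideanSpace.norm_eq, unitFst, hn₁']

theorem norm_unitSnd (hn₂ : n₂ ≠ 0) : ‖unitSnd n₁ n₂‖ = 1 := by
  have hn₂' : (n₂ : ℝ) ≠ 0 := Nat.cast_ne_zero.2 hn₂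
  simp [EuclideanSpace.norm_eq, unitSnd, hn₂']

theorem inner_unitFst_unitSnd : inner ℝ (unitFst n₁ n₂) (unitSnd n₁ n₂) = (0 : ℝ) := by
  simp [unitFst, unitSnd, PiLp.inner_apply]

theorem inner_planeDir (hn₁ : n₁ ≠ 0) (hn₂ : n₂ ≠ 0) (ω ω' : ℝ) :
    inner ℝ (planeDir n₁ n₂ ω) (planeDir n₁ n₂ ω') = Real.cos (ω - ω') := by
  rw [← sub_sub_sub_cancel_right ω ω' (omegaZero n₁ n₂), Real.cos_sub]
  simp only [planeDir, inner_add_left, inner_add_right, real_inner_smul_left,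
    real_inner_smul_right, real_inner_self_eq_norm_sq, norm_unitFst hn₁, norm_unitSnd hn₂,
    inner_unitFst_unitSnd, real_inner_comm (unitFst n₁ n₂) (unitSnd n₁ n₂)]
  ring

theorem planeDir_eq (ω : ℝ) : planeDir n₁ n₂ ω
    = Real.cos ω • planeDir n₁ n₂ 0 + Real.sin ω • planeDir n₁ n₂ (Real.pi / 2) := by
  simp only [planeDir, zero_sub, Real.cos_neg, Real.sin_neg, Real.cos_sub, Real.sin_sub,
    Real.cos_pi_div_two, Real.sin_pi_div_two]
  module

/-- Cartesian coordinates on the plane spanned by `unitFst` and `unitSnd`, with axes in the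
directions `ω = 0` and `ω = π / 2`. -/
def planeMap (n₁ n₂ : ℕ) : ℝ × ℝ →ₗ[ℝ] Euc (Fin n₁ ⊕ Fin n₂) :=
  (LinearMap.toSpanSingleton ℝ _ (planeDir n₁ n₂ 0)).coprod
    (LinearMap.toSpanSingleton ℝ _ (planeDir n₁ n₂ (Real.pi / 2)))

theorem planeMap_polar (r ω : ℝ) :
    planeMap n₁ n₂ (r * Real.cos ω, r * Real.sin ω) = r • planeDir n₁ n₂ ω := by
  rw [planeDir_eq, smul_add, smul_smul, smul_smul]
  rfl

theorem inner_planeDir_zero_planeMap (hn₁ : n₁ ≠ 0) (hn₂ : n₂ ≠ 0) (y : ℝ × ℝ) :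
    inner ℝ (planeDir n₁ n₂ 0) (planeMap n₁ n₂ y) = y.1 := by
  simp [planeMap, inner_add_right, inner_smul_right, inner_planeDir hn₁ hn₂,
    -inner_self_eq_norm_sq_to_K]

theorem planeMap_injective (hn₁ : n₁ ≠ 0) (hn₂ : n₂ ≠ 0) :
    Function.Injective (planeMap n₁ n₂) := by
  have hsnd (y : ℝ × ℝ) : inner ℝ (planeDir n₁ n₂ (Real.pi / 2)) (planeMap n₁ n₂ y) = y.2 := by
    simp [planeMap, inner_add_right, inner_smul_right, inner_planeDir hn₁ hn₂,
      -inner_self_eq_norm_sq_to_K]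
  intro y z h
  refine Prod.ext ?_ ?_
  · rw [← inner_planeDir_zero_planeMap hn₁ hn₂ y, h, inner_planeDir_zero_planeMap hn₁ hn₂]
  · rw [← hsnd y, h, hsnd]

theorem range_planeMap :
    LinearMap.range (planeMap n₁ n₂) = Submodule.span ℝ {unitFst n₁ n₂, unitSnd n₁ n₂} := by
  refine le_antisymm ?_ (Submodule.span_le.2 (Set.pair_subset ?_ ?_))
  · have hmem (ω : ℝ) : planeDir n₁ n₂ ω ∈ Submodule.span ℝ {unitFst n₁ n₂, unitSnd n₁ n₂} :=
      Submodule.mem_span_pair.2 ⟨_, _, rfl⟩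
    rintro _ ⟨y, rfl⟩
    exact add_mem (Submodule.smul_mem _ _ (hmem _)) (Submodule.smul_mem _ _ (hmem _))
  · have hdir : unitFst n₁ n₂ = planeDir n₁ n₂ (omegaZero n₁ n₂) := by simp [planeDir]
    exact ⟨_, by rw [hdir, ← one_smul ℝ (planeDir _ _ _), ← planeMap_polar]⟩
  · have hdir : unitSnd n₁ n₂ = planeDir n₁ n₂ (omegaZero n₁ n₂ + Real.pi / 2) := by
      simp [planeDir]
    exact ⟨_, by rw [hdir, ← one_smul ℝ (planeDir _ _ _), ← planeMap_polar]⟩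

/-- Linear coordinates `x = planeMap n₁ n₂ y + η` along and orthogonal to the plane spanned by
`unitFst` and `unitSnd`. -/
def planeChart (hn₁ : n₁ ≠ 0) (hn₂ : n₂ ≠ 0) :
    ((ℝ × ℝ) × (Submodule.span ℝ {unitFst n₁ n₂, unitSnd n₁ n₂})ᗮ) ≃L[ℝ] Euc (Fin n₁ ⊕ Fin n₂) :=
  orthogonalChart (planeMap n₁ n₂) (planeMap_injective hn₁ hn₂) range_planeMap

theorem planeChart_apply (hn₁ : n₁ ≠ 0) (hn₂ : n₂ ≠ 0) (y : ℝ × ℝ)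
    (η : (Submodule.span ℝ {unitFst n₁ n₂, unitSnd n₁ n₂})ᗮ) :
    planeChart hn₁ hn₂ (y, η) = planeMap n₁ n₂ y + (η : Euc (Fin n₁ ⊕ Fin n₂)) :=
  orthogonalChart_apply _ _ y η

theorem finrank_orthogonal_plane (hn₁ : n₁ ≠ 0) (hn₂ : n₂ ≠ 0) :
    finrank ℝ (Submodule.span ℝ {unitFst n₁ n₂, unitSnd n₁ n₂})ᗮ = n₁ + n₂ - 2 := by
  have h := finrank_orthogonal_range (planeMap_injective hn₁ hn₂) range_planeMap
  simpa using h

theorem cos_omegaZero : Real.cos (omegaZero n₁ n₂) = √((n₂ : ℝ) / ((n₁ : ℝ) + n₂)) := by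
  have hle : (n₂ : ℝ) ≤ n₁ + n₂ := le_add_of_nonneg_left (Nat.cast_nonneg n₁)
  exact Real.cos_arccos (by linarith [Real.sqrt_nonneg ((n₂ : ℝ) / ((n₁ : ℝ) + n₂))])
    (Real.sqrt_le_one.2 (div_le_one_of_le₀ hle (by positivity)))

theorem sin_omegaZero (hn₁ : n₁ ≠ 0) :
    Real.sin (omegaZero n₁ n₂) = √((n₁ : ℝ) / ((n₁ : ℝ) + n₂)) := by
  rw [omegaZero, Real.sin_arccos, Real.sq_sqrt (by positivity)]
  congr 1
  field_simp
  ring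

theorem sampleMean_sub_sampleMean (hn₁ : n₁ ≠ 0) (hn₂ : n₂ ≠ 0) (x : Euc (Fin n₁ ⊕ Fin n₂)) :
    sampleMean (fstSample x) - sampleMean (sndSample x)
      = √(1 / (n₁ : ℝ) + 1 / (n₂ : ℝ)) * inner ℝ (planeDir n₁ n₂ 0) x := by
  have hcos : √(1 / (n₁ : ℝ) + 1 / (n₂ : ℝ)) * (Real.cos (omegaZero n₁ n₂) * √n₁) = 1 := by
    rw [cos_omegaZero, ← Real.sqrt_mul (by positivity), ← Real.sqrt_mul (by positivity),
      Real.sqrt_eq_one]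
    field_simp
    ring
  have hsin : √(1 / (n₁ : ℝ) + 1 / (n₂ : ℝ)) * (Real.sin (omegaZero n₁ n₂) * √n₂) = 1 := by
    rw [sin_omegaZero hn₁, ← Real.sqrt_mul (by positivity), ← Real.sqrt_mul (by positivity),
      Real.sqrt_eq_one]
    field_simp
    ring
  simp only [planeDir, zero_sub, Real.cos_neg, Real.sin_neg, inner_add_left, real_inner_smul_left,
    inner_unitFst, inner_unitSnd]
  linear_combination sampleMean (sndSample x) * hsin - sampleMean (fstSample x) * hcos

/-- The denominator `√(α S₁² + β S₂²)` of the two-sample `t`-statistic. -/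
def pooledSD (α β : ℝ) (x : Euc (Fin n₁ ⊕ Fin n₂)) : ℝ :=
  √(α * sampleVar (fstSample x) + β * sampleVar (sndSample x))

theorem continuous_pooledSD (α β : ℝ) : Continuous (pooledSD (n₁ := n₁) (n₂ := n₂) α β) := by
  have hfst : Continuous fun x : Euc (Fin n₁ ⊕ Fin n₂) => sampleVar (fstSample x) :=
    continuous_sampleVar.comp (by unfold fstSample; fun_prop)
  have hsnd : Continuous fun x : Euc (Fin n₁ ⊕ Fin n₂) => sampleVar (sndSample x) :=
    continuous_sampleVar.comp (by unfold sndSample; fun_prop)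
  exact ((hfst.const_mul α).add (hsnd.const_mul β)).sqrt

theorem pooledSD_smul (α β : ℝ) {t : ℝ} (ht : 0 ≤ t) (x : Euc (Fin n₁ ⊕ Fin n₂)) :
    pooledSD α β (t • x) = t * pooledSD α β x := by
  have hfst : sampleVar (fstSample (t • x)) = t ^ 2 * sampleVar (fstSample x) :=
    sampleVar_smul t (fstSample x)
  have hsnd : sampleVar (sndSample (t • x)) = t ^ 2 * sampleVar (sndSample x) :=
    sampleVar_smul t (sndSample x)
  rw [pooledSD, hfst, hsnd, mul_left_comm, mul_left_comm β, ← mul_add,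
    Real.sqrt_mul (sq_nonneg t), Real.sqrt_sq ht, pooledSD]

theorem pooledSD_add (α β : ℝ) {z : Euc (Fin n₁ ⊕ Fin n₂)}
    (hz : z ∈ Submodule.span ℝ {unitFst n₁ n₂, unitSnd n₁ n₂}) (x : Euc (Fin n₁ ⊕ Fin n₂)) :
    pooledSD α β (z + x) = pooledSD α β x := by
  obtain ⟨a, b, rfl⟩ := Submodule.mem_span_pair.1 hz
  have hfst : fstSample (a • unitFst n₁ n₂ + b • unitSnd n₁ n₂ + x)
      = fun i => a * (1 / √n₁) + fstSample x i := by
    ext i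
    simp [fstSample, unitFst, unitSnd]
  have hsnd : sndSample (a • unitFst n₁ n₂ + b • unitSnd n₁ n₂ + x)
      = fun i => b * (1 / √n₂) + sndSample x i := by
    ext i
    simp [sndSample, unitFst, unitSnd]
  rw [pooledSD, hfst, hsnd, sampleVar_const_add, sampleVar_const_add, pooledSD]

theorem pooledSD_pos (hn₁ : 2 ≤ n₁) (hn₂ : 2 ≤ n₂) {α β : ℝ} (hα : 0 < α) (hβ : 0 < β)
    {x : Euc (Fin n₁ ⊕ Fin n₂)} (hfst : sampleMean (fstSample x) = 0)
    (hsnd : sampleMean (sndSample x) = 0) (hx : x ≠ 0) : 0 < pooledSD α β x := by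
  refine Real.sqrt_pos.2 ?_
  by_cases hzero : fstSample x = 0
  · have hne : sndSample x ≠ 0 := fun h => hx <| PiLp.ext <| Sum.rec (congrFun hzero) (congrFun h)
    exact add_pos_of_nonneg_of_pos (mul_nonneg hα.le (sampleVar_nonneg _))
      (mul_pos hβ (sampleVar_pos hn₂ hsnd hne))
  · exact add_pos_of_pos_of_nonneg (mul_pos hα (sampleVar_pos hn₁ hfst hzero))
      (mul_nonneg hβ.le (sampleVar_nonneg _))

theorem sampleMean_fstSample_eq_zero (hn₁ : n₁ ≠ 0) {x : Euc (Fin n₁ ⊕ Fin n₂)}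
    (hx : x ∈ (Submodule.span ℝ {unitFst n₁ n₂, unitSnd n₁ n₂})ᗮ) :
    sampleMean (fstSample x) = 0 := by
  have h := hx _ (Submodule.subset_span (Set.mem_insert _ _))
  rw [inner_unitFst] at h
  exact (mul_eq_zero.1 h).resolve_left (by positivity)

theorem sampleMean_sndSample_eq_zero (hn₂ : n₂ ≠ 0) {x : Euc (Fin n₁ ⊕ Fin n₂)}
    (hx : x ∈ (Submodule.span ℝ {unitFst n₁ n₂, unitSnd n₁ n₂})ᗮ) :
    sampleMean (sndSample x) = 0 := by
  have h := hx _ (Submodule.subset_span (Set.mem_insert_of_mem _ rfl))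
  rw [inner_unitSnd] at h
  exact (mul_eq_zero.1 h).resolve_left (by positivity)

theorem isGauge_pooledSD (hn₁ : 2 ≤ n₁) (hn₂ : 2 ≤ n₂) {α β : ℝ} (hα : 0 < α) (hβ : 0 < β) :
    IsGauge fun η : (Submodule.span ℝ {unitFst n₁ n₂, unitSnd n₁ n₂})ᗮ =>
      pooledSD α β (η : Euc (Fin n₁ ⊕ Fin n₂)) where
  continuous := (continuous_pooledSD α β).comp continuous_subtype_val
  map_smul t η ht := pooledSD_smul α β ht.le _
  pos η hη := pooledSD_pos hn₁ hn₂ hα hβ (sampleMean_fstSample_eq_zero (by omega) η.2)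
    (sampleMean_sndSample_eq_zero (by omega) η.2) (by simpa using hη)

theorem twoSampleT_planeChart (hn₁ : n₁ ≠ 0) (hn₂ : n₂ ≠ 0) (α β : ℝ) (y : ℝ × ℝ)
    (η : (Submodule.span ℝ {unitFst n₁ n₂, unitSnd n₁ n₂})ᗮ) :
    twoSampleT n₁ n₂ α β (planeChart hn₁ hn₂ (y, η))
      = √(1 / (n₁ : ℝ) + 1 / (n₂ : ℝ)) * (y.1 / pooledSD α β (η : Euc (Fin n₁ ⊕ Fin n₂))) := by
  have hplane (z : ℝ × ℝ) :
      planeMap n₁ n₂ z ∈ Submodule.span ℝ {unitFst n₁ n₂, unitSnd n₁ n₂} :=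
    range_planeMap (n₁ := n₁) (n₂ := n₂) ▸ LinearMap.mem_range_self _ z
  have hη : inner ℝ (planeDir n₁ n₂ 0) (η : Euc (Fin n₁ ⊕ Fin n₂)) = 0 :=
    η.2 _ (Submodule.mem_span_pair.2 ⟨_, _, rfl⟩)
  rw [twoSampleT, ← pooledSD, planeChart_apply, pooledSD_add α β (hplane y),
    sampleMean_sub_sampleMean hn₁ hn₂, inner_add_right, inner_planeDir_zero_planeMap hn₁ hn₂, hη,
    add_zero, mul_div_assoc]

theorem measurable_twoSampleT (α β : ℝ) : Measurable (twoSampleT n₁ n₂ α β) := by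
  have hfst : Continuous fun x : Euc (Fin n₁ ⊕ Fin n₂) => sampleMean (fstSample x) :=
    continuous_sampleMean.comp (by unfold fstSample; fun_prop)
  have hsnd : Continuous fun x : Euc (Fin n₁ ⊕ Fin n₂) => sampleMean (sndSample x) :=
    continuous_sampleMean.comp (by unfold sndSample; fun_prop)
  exact (hfst.sub hsnd).measurable.div (continuous_pooledSD α β).measurable

theorem isRatioStatistic_twoSampleT (hn₁ : 2 ≤ n₁) (hn₂ : 2 ≤ n₂) {α β : ℝ} (hα : 0 < α)
    (hβ : 0 < β) :
    IsRatioStatistic (twoSampleT n₁ n₂ α β) (planeChart (by omega) (by omega)) Prod.fst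
      (fun η => pooledSD α β (η : Euc (Fin n₁ ⊕ Fin n₂)))
      (fun u => u / √(1 / (n₁ : ℝ) + 1 / (n₂ : ℝ))) := by
  have hscale : 0 < √(1 / (n₁ : ℝ) + 1 / (n₂ : ℝ)) := by positivity
  exact
    { measurable := measurable_twoSampleT α β
      continuous := continuous_fst
      isGauge := isGauge_pooledSD hn₁ hn₂ hα hβ
      tendsto := tendsto_id.atTop_div_const hscale
      lt_iff := Eventually.of_forall fun u y η => by
        rw [twoSampleT_planeChart, div_lt_iff₀' hscale] }

theorem setLIntegral_plane_polar (hn₁ : n₁ ≠ 0) (hn₂ : n₂ ≠ 0) {f : ℝ × ℝ → ℝ≥0∞}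
    (hf : Measurable f) :
    ∫⁻ y in {y : ℝ × ℝ | 0 < y.1}, ENNReal.ofReal
        (y.1 ^ finrank ℝ (Submodule.span ℝ {unitFst n₁ n₂, unitSnd n₁ n₂})ᗮ) * f y
      = ∫⁻ ω in Set.Icc (-(Real.pi / 2)) (Real.pi / 2),
          ENNReal.ofReal (Real.cos ω ^ (n₁ + n₂ - 2)) *
            ∫⁻ r in Set.Ioi (0 : ℝ), ENNReal.ofReal (r ^ (n₁ + n₂ - 1)) *
              f (r * Real.cos ω, r * Real.sin ω) := by
  rw [finrank_orthogonal_plane hn₁ hn₂, lintegral_halfPlane_pow_mul _ hf,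
    show n₁ + n₂ - 2 + 1 = n₁ + n₂ - 1 by omega]

theorem TwoSampleRegular.exists_tubeSupIntegral_lt_top (hn₁ : n₁ ≠ 0) (hn₂ : n₂ ≠ 0)
    {g : Euc (Fin n₁ ⊕ Fin n₂) → ℝ} (hg : TwoSampleRegular n₁ n₂ g) :
    ∃ ε > 0, tubeSupIntegral volume Prod.fst ε
      (fun p => ENNReal.ofReal (g (planeChart hn₁ hn₂ p))) < ⊤ := by
  obtain ⟨ε, hε, hfin⟩ := hg.integrable
  refine ⟨ε, hε, lt_of_le_of_lt ?_ hfin⟩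
  have hcont := hg.density.continuous
  rw [tubeSupIntegral, setLIntegral_plane_polar hn₁ hn₂]
  · refine setLIntegral_mono' measurableSet_Icc fun ω _ => ?_
    gcongr with r
    refine iSup_mono' fun ξ => ⟨⟨Real.cos ω • (ξ.1 : Euc (Fin n₁ ⊕ Fin n₂)),
      Submodule.smul_mem _ _ ξ.1.2, ?_⟩, le_of_eq ?_⟩
    · rw [norm_smul]
      exact (mul_le_of_le_one_left (norm_nonneg _) (Real.abs_cos_le_one ω)).trans_lt ξ.2
    · rw [planeChart_apply, planeMap_polar, Submodule.coe_smul, mul_smul, smul_add]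
  · refine (lowerSemicontinuous_iSup fun ξ => Continuous.lowerSemicontinuous ?_).measurable
    exact ENNReal.continuous_ofReal.comp (by fun_prop)

theorem TwoSampleRegular.isTubeRegular (hn₁ : n₁ ≠ 0) (hn₂ : n₂ ≠ 0)
    {g : Euc (Fin n₁ ⊕ Fin n₂) → ℝ} (hg : TwoSampleRegular n₁ n₂ g) :
    IsTubeRegular volume (planeChart hn₁ hn₂) Prod.fst g where
  continuous := hg.density.continuous
  pos := by
    obtain ⟨r, hr, ω, hω, hpos⟩ := hg.pos
    refine ⟨(r * Real.cos ω, r * Real.sin ω), ?_, by simpa [planeChart_apply, planeMap_polar]⟩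
    have hclosure : closure {y : ℝ × ℝ | 0 < y.1} = Prod.fst ⁻¹' Set.Ici 0 := by
      rw [← closure_Ioi, isOpenMap_fst.preimage_closure_eq_closure_preimage continuous_fst]
      rfl
    rw [hclosure]
    exact mul_nonneg hr (Real.cos_nonneg_of_mem_Icc hω)
  integrable := hg.exists_tubeSupIntegral_lt_top hn₁ hn₂

theorem twoSampleK_eq_mul_axisIntegral (hn₁ : n₁ ≠ 0) (hn₂ : n₂ ≠ 0) (α β : ℝ)
    {g : Euc (Fin n₁ ⊕ Fin n₂) → ℝ} (hg : Measurable g) :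
    twoSampleK n₁ n₂ α β g = ENNReal.ofReal (twoSampleC n₁ n₂ α β) *
      axisIntegral volume Prod.fst fun p => ENNReal.ofReal (g (planeChart hn₁ hn₂ p)) := by
  have hchart : Measurable (planeChart hn₁ hn₂) := (planeChart hn₁ hn₂).continuous.measurable
  rw [twoSampleK, axisIntegral, setLIntegral_plane_polar hn₁ hn₂ (by fun_prop)]
  simp only [planeChart_apply, planeMap_polar, Submodule.coe_zero, add_zero]

theorem twoSampleC_pos (hn₁ : 2 ≤ n₁) (hn₂ : 2 ≤ n₂) {α β : ℝ} (hα : 0 < α) (hβ : 0 < β) :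
    0 < twoSampleC n₁ n₂ α β := by
  have hn₁' : (2 : ℝ) ≤ n₁ := by exact_mod_cast hn₁
  have hn₂' : (2 : ℝ) ≤ n₂ := by exact_mod_cast hn₂
  have hdf₁ : (0 : ℝ) < (n₁ : ℝ) - 1 := by linarith
  have hdf₂ : (0 : ℝ) < (n₂ : ℝ) - 1 := by linarith
  have hdf : (0 : ℝ) < (n₁ : ℝ) + n₂ - 2 := by linarith
  have hGamma : 0 < Real.Gamma (((n₁ : ℝ) + n₂ - 1) / 2) := Real.Gamma_pos_of_pos (by linarith)
  unfold twoSampleC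
  positivity

theorem tailComparison_twoSample (hn₁ : 2 ≤ n₁) (hn₂ : 2 ≤ n₂) {α β : ℝ} (hα : 0 < α)
    (hβ : 0 < β) :
    TailComparison (twoSampleT n₁ n₂ α β) (TwoSampleRegular n₁ n₂) (twoSampleK n₁ n₂ α β) := by
  have hn₁' : n₁ ≠ 0 := by omega
  have hn₂' : n₂ ≠ 0 := by omega
  have : Nontrivial (Submodule.span ℝ {unitFst n₁ n₂, unitSnd n₁ n₂})ᗮ := by
    have hrank := finrank_orthogonal_plane hn₁' hn₂'
    exact nontrivial_of_finrank_pos (R := ℝ) (by omega)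
  have : (volume : Measure (ℝ × ℝ)).IsAddHaarMeasure := Measure.prod.instIsAddHaarMeasure _ _
  exact (isRatioStatistic_twoSampleT hn₁ hn₂ hα hβ).tailComparison
    (ENNReal.ofReal_pos.2 (twoSampleC_pos hn₁ hn₂ hα hβ)).ne' ENNReal.ofReal_ne_top
    (fun g hg => hg.isTubeRegular hn₁' hn₂')
    fun g hg => twoSampleK_eq_mul_axisIntegral hn₁' hn₂' α β hg.density.continuous.measurable

theorem studentTwoSampleT_eq_twoSampleT (n₁ n₂ : ℕ) :
    studentTwoSampleT n₁ n₂ = twoSampleT n₁ n₂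
      (((n₁ : ℝ) - 1) / ((n₁ : ℝ) + n₂ - 2) * (1 / (n₁ : ℝ) + 1 / (n₂ : ℝ)))
      (((n₂ : ℝ) - 1) / ((n₁ : ℝ) + n₂ - 2) * (1 / (n₁ : ℝ) + 1 / (n₂ : ℝ))) := by
  ext x
  rw [studentTwoSampleT, twoSampleT]
  congr 2
  ring

theorem welchT_eq_twoSampleT (n₁ n₂ : ℕ) :
    welchT n₁ n₂ = twoSampleT n₁ n₂ (1 / (n₁ : ℝ)) (1 / (n₂ : ℝ)) := by
  ext x
  rw [welchT, twoSampleT]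
  congr 2
  ring

end TwoSample

section FStatistic

variable {n₁ n₂ : ℕ}

/-- Linear coordinates `(x, y) = (x, r I + η)` on the space of pairs of samples, where `I` is
`unitDiag n₂`. -/
def sndDiagChart (n₁ : ℕ) (hn₂ : n₂ ≠ 0) :
    ((Euc (Fin n₁) × ℝ) × (ℝ ∙ unitDiag n₂)ᗮ) ≃L[ℝ] Euc (Fin n₁) × Euc (Fin n₂) :=
  (ContinuousLinearEquiv.prodAssoc ℝ _ _ _).trans
    ((ContinuousLinearEquiv.refl ℝ _).prodCongr (diagChart hn₂))

theorem sndDiagChart_apply (hn₂ : n₂ ≠ 0) (a : Euc (Fin n₁) × ℝ) (η : (ℝ ∙ unitDiag n₂)ᗮ) :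
    sndDiagChart n₁ hn₂ (a, η) = (a.1, a.2 • unitDiag n₂ + (η : Euc (Fin n₂))) := by
  rw [← diagChart_apply hn₂]
  rfl

theorem isRatioStatistic_fStat (n₁ : ℕ) (hn₂ : 2 ≤ n₂) :
    IsRatioStatistic (fStat n₁ n₂) (sndDiagChart n₁ (by omega)) (fun a => sampleSD a.1)
      (fun η => sampleSD (η : Euc (Fin n₂))) Real.sqrt where
  measurable := (continuous_sampleVar.comp (by fun_prop)).measurable.div
    (continuous_sampleVar.comp (by fun_prop)).measurable
  continuous := continuous_sampleSD.comp (by fun_prop)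
  isGauge := isGauge_sampleSD hn₂
  tendsto := Real.tendsto_sqrt_atTop
  lt_iff := by
    filter_upwards [eventually_ge_atTop 0] with u hu a η
    rw [sndDiagChart_apply, fStat, sampleVar_smul_unitDiag_add, sampleSD, sampleSD,
      ← Real.sqrt_div (sampleVar_nonneg _), Real.sqrt_lt_sqrt_iff hu]

theorem setLIntegral_sampleSD_pos (hn₂ : 2 ≤ n₂) (f : Euc (Fin n₁) × ℝ → ℝ≥0∞) :
    ∫⁻ a in {a | 0 < sampleSD a.1}, ENNReal.ofReal (sampleSD a.1 ^ (n₂ - 1)) * f a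
        ∂(volume : Measure (Euc (Fin n₁))).prod volume
      = ∫⁻ a, ENNReal.ofReal (sampleSD a.1 ^ (n₂ - 1)) * f a
          ∂(volume : Measure (Euc (Fin n₁))).prod volume := by
  refine setLIntegral_eq_of_support_subset fun a ha => (Real.sqrt_nonneg _).lt_of_ne fun h => ha ?_
  have hzero : sampleSD a.1 = 0 := h.symm
  simp only [hzero, zero_pow (show n₂ - 1 ≠ 0 by omega), ENNReal.ofReal_zero, zero_mul]

theorem FRegular.isTubeRegular (hn₂ : 2 ≤ n₂) {g : Euc (Fin n₁) × Euc (Fin n₂) → ℝ}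
    (hg : FRegular n₁ n₂ g) :
    IsTubeRegular (volume.prod volume) (sndDiagChart n₁ (by omega)) (fun a => sampleSD a.1) g where
  continuous := hg.density.continuous
  pos := by
    obtain ⟨x, r, hpos⟩ := hg.pos
    have hSD : 0 < sampleSD x := pos_of_mul_pos_left hpos (hg.density.nonneg _)
    refine ⟨(x, r), subset_closure hSD, ?_⟩
    simpa [sndDiagChart_apply] using pos_of_mul_pos_right hpos hSD.le
  integrable := by
    obtain ⟨ε, hε, hfin⟩ := hg.integrable
    refine ⟨ε, hε, lt_of_le_of_lt ?_ hfin⟩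
    rw [tubeSupIntegral, finrank_orthogonal_unitDiag (by omega), setLIntegral_sampleSD_pos hn₂]
    refine (lintegral_prod_le _).trans_eq (lintegral_congr fun x => ?_)
    simp only [lintegral_const_mul' _ _ ENNReal.ofReal_ne_top, sndDiagChart_apply,
      Submodule.coe_smul]
    refine congrArg _ (lintegral_congr fun r => ?_)
    exact iSup_submodule_norm_lt _ ε fun ξ =>
      ENNReal.ofReal (g (x, r • unitDiag n₂ + sampleSD x • ξ))

theorem fK_eq_mul_axisIntegral (hn₂ : 2 ≤ n₂) {g : Euc (Fin n₁) × Euc (Fin n₂) → ℝ}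
    (hg : Continuous g) :
    fK n₁ n₂ g = ENNReal.ofReal
        (Real.Gamma (((n₁ : ℝ) - 1) / 2) * (Real.pi * ((n₁ : ℝ) - 1)) ^ (((n₂ : ℝ) - 1) / 2)
          / Real.Gamma (((n₁ : ℝ) + n₂ - 2) / 2)) *
      axisIntegral (volume.prod volume) (fun a : Euc (Fin n₁) × ℝ => sampleSD a.1)
        fun p => ENNReal.ofReal (g (sndDiagChart n₁ (by omega) p)) := by
  have hweight : Continuous fun a : Euc (Fin n₁) × ℝ => sampleSD a.1 ^ (n₂ - 1) :=
    (continuous_sampleSD.comp (by fun_prop)).pow _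
  have hdensity : Continuous fun a : Euc (Fin n₁) × ℝ => g (a.1, a.2 • unitDiag n₂) := by fun_prop
  simp only [axisIntegral, finrank_orthogonal_unitDiag (m := n₂) (by omega),
    setLIntegral_sampleSD_pos hn₂, sndDiagChart_apply, Submodule.coe_zero, add_zero]
  rw [fK, lintegral_prod (fun a : Euc (Fin n₁) × ℝ =>
      ENNReal.ofReal (sampleSD a.1 ^ (n₂ - 1)) * ENNReal.ofReal (g (a.1, a.2 • unitDiag n₂)))
    (hweight.measurable.ennreal_ofReal.mul hdensity.measurable.ennreal_ofReal).aemeasurable]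
  simp only [lintegral_const_mul' _ _ ENNReal.ofReal_ne_top]

theorem fK_constant_pos (hn₁ : 2 ≤ n₁) (hn₂ : 2 ≤ n₂) :
    0 < Real.Gamma (((n₁ : ℝ) - 1) / 2) * (Real.pi * ((n₁ : ℝ) - 1)) ^ (((n₂ : ℝ) - 1) / 2)
      / Real.Gamma (((n₁ : ℝ) + n₂ - 2) / 2) := by
  have hn₁' : (2 : ℝ) ≤ n₁ := by exact_mod_cast hn₁
  have hn₂' : (2 : ℝ) ≤ n₂ := by exact_mod_cast hn₂
  have hpi : 0 < Real.pi * ((n₁ : ℝ) - 1) := mul_pos Real.pi_pos (by linarith)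
  exact div_pos (mul_pos (Real.Gamma_pos_of_pos (by linarith)) (Real.rpow_pos_of_pos hpi _))
    (Real.Gamma_pos_of_pos (by linarith))

theorem tailComparison_fStat (hn₁ : 2 ≤ n₁) (hn₂ : 2 ≤ n₂) :
    TailComparison (fStat n₁ n₂) (FRegular n₁ n₂) (fK n₁ n₂) := by
  have := nontrivial_orthogonal_unitDiag hn₂
  have : (volume : Measure (Euc (Fin n₁) × Euc (Fin n₂))).IsAddHaarMeasure :=
    Measure.prod.instIsAddHaarMeasure _ _
  exact (isRatioStatistic_fStat n₁ hn₂).tailComparison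
    (ENNReal.ofReal_pos.2 (fK_constant_pos hn₁ hn₂)).ne' ENNReal.ofReal_ne_top
    (fun g hg => hg.isTubeRegular hn₂) fun g hg => fK_eq_mul_axisIntegral hn₂ hg.density.continuous

end FStatistic

end TestTails

end

theorem theorem1p1 :
    (∀ n : ℕ, 2 ≤ n →
      TestTails.TailComparison (TestTails.oneSampleT n) (TestTails.OneSampleRegular n)
        (TestTails.oneSampleK n)) ∧
    (∀ n₁ n₂ : ℕ, 2 ≤ n₁ → 2 ≤ n₂ →
      (∀ α β : ℝ, 0 < α → 0 < β →
        TestTails.TailComparison (TestTails.twoSampleT n₁ n₂ α β)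
          (TestTails.TwoSampleRegular n₁ n₂) (TestTails.twoSampleK n₁ n₂ α β)) ∧
      TestTails.TailComparison (TestTails.studentTwoSampleT n₁ n₂)
        (TestTails.TwoSampleRegular n₁ n₂)
        (TestTails.twoSampleK n₁ n₂
          (((n₁ : ℝ) - 1) / ((n₁ : ℝ) + n₂ - 2) * (1 / (n₁ : ℝ) + 1 / (n₂ : ℝ)))
          (((n₂ : ℝ) - 1) / ((n₁ : ℝ) + n₂ - 2) * (1 / (n₁ : ℝ) + 1 / (n₂ : ℝ)))) ∧
      TestTails.TailComparison (TestTails.welchT n₁ n₂)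
        (TestTails.TwoSampleRegular n₁ n₂)
        (TestTails.twoSampleK n₁ n₂ (1 / (n₁ : ℝ)) (1 / (n₂ : ℝ)))) ∧
    (∀ n₁ n₂ : ℕ, 2 ≤ n₁ → 2 ≤ n₂ →
      TestTails.TailComparison (TestTails.fStat n₁ n₂) (TestTails.FRegular n₁ n₂)
        (TestTails.fK n₁ n₂)) := by
  refine ⟨fun n hn => TestTails.tailComparison_oneSample hn, fun n₁ n₂ hn₁ hn₂ => ?_,
    fun n₁ n₂ hn₁ hn₂ => TestTails.tailComparison_fStat hn₁ hn₂⟩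
  have hdf₁ : (0 : ℝ) < (n₁ : ℝ) - 1 := sub_pos.2 (by exact_mod_cast hn₁)
  have hdf₂ : (0 : ℝ) < (n₂ : ℝ) - 1 := sub_pos.2 (by exact_mod_cast hn₂)
  have hdf : (0 : ℝ) < (n₁ : ℝ) + n₂ - 2 := by linarith
  refine ⟨fun α β hα hβ => TestTails.tailComparison_twoSample hn₁ hn₂ hα hβ, ?_, ?_⟩
  · rw [TestTails.studentTwoSampleT_eq_twoSampleT]
    exact TestTails.tailComparison_twoSample hn₁ hn₂ (by positivity) (by positivity)
  · rw [TestTails.welchT_eq_twoSampleT]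
    exact TestTails.tailComparison_twoSample hn₁ hn₂ (by positivity) (by positivity)
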